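/- Let $n\ge 2$ and let $\Lambda$ be an Artinian algebra, that is, an algebra that is finitely generated as a module over a commutative Artinian ring $R$. Modules are left modules, and $\operatorname{mod}\Lambda$ is the category of finitely generated $\Lambda$-modules. For a module $M$ let $0\to M\to I^0(M)\to I^1(M)\to\cdots$ be a minimal injective resolution; in particular $I^0(M)$ is the injective envelope of $M$. Suppose that $\operatorname{gl.dim}\Lambda=n$ and that $\Lambda$ is an $(n-1)$-Auslander algebra, i.e. $\operatorname{gl.dim}\Lambda\le n$ and $I^0(\Lambda),\dots,I^{n-1}(\Lambda)$ are projective. Let $\mathscr C$ be a maximal $(n-1)$-orthogonal subcategory of $\operatorname{mod}\Lambda$, i.e. a functorially finite full subcategory of $\operatorname{mod}\Lambda$ such that $$\mathscr C=\{X\in\operatorname{mod}\Lambda : \operatorname{Ext}^i_\Lambda(X,C)=0 \text{ for all } C\in\mathscr C,\ 1\le i\le n-1\}=\{X\in\operatorname{mod}\Lambda : \operatorname{Ext}^i_\Lambda(C,X)=0 \text{ for all } C\in\mathscr C,\ 1\le i\le n-1\}.$$ Let $S$ be a simple $\Lambda$-module with $\operatorname{pd}_\Lambda S=n$. Then: (1)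 $S$ is injective if and only if $S\in\mathscr C$ and $\operatorname{Hom}_\Lambda(S,C)=0$ for every indecomposable module $C\in\mathscr C$ with $C\not\cong I^0(S)$. (2) $1\le\operatorname{id}_\Lambda S\le n-1$ if and only if $S\notin\mathscr C$ and $\operatorname{Hom}_\Lambda(S,C)=0$ for every indecomposable module $C\in\mathscr C$ with $C\not\cong I^0(S)$. (3) $\operatorname{id}_\Lambda S=n$ if and only if $\operatorname{Hom}_\Lambda(S,C)\ne 0$ for some indecomposable module $C\in\mathscr C$ with $C\not\cong I^0(S)$. Moreover, each of (1), (2), (3) also holds with "indecomposable" replaced by "non-projective indecomposable". -/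

import Mathlib

open CategoryTheory

universe u

namespace HigherAuslander

/-- A submodule `U` of `M` is essential if it meets every nonzero submodule of `M` nontrivially. -/
def IsEssentialSubmodule {Λ : Type u} [Ring Λ] {M : Type u} [AddCommGroup M] [Module Λ M]
    (U : Submodule Λ M) : Prop :=
  ∀ N : Submodule Λ M, N ≠ ⊥ → N ⊓ U ≠ ⊥

/-- `f : M ⟶ E` is an injective envelope of `M`: a monomorphism onto an essential submodule of an
injective module. -/
structure IsInjectiveEnvelope {Λ : Type u} [Ring Λ] {M E : ModuleCat.{u} Λ} (f : M ⟶ E) :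
    Prop where
  mono : Mono f
  injective : Injective E
  essential : IsEssentialSubmodule (LinearMap.range f.hom)

/-- `E` is (isomorphic to) the injective envelope `I⁰(M)` of `M`. Injective envelopes are unique up
to isomorphism, so `E ≅ I⁰(M)` holds exactly when `E` is the target of an injective envelope of
`M`. -/
def IsInjectiveEnvelopeOf {Λ : Type u} [Ring Λ] (M E : ModuleCat.{u} Λ) : Prop :=
  ∃ f : M ⟶ E, IsInjectiveEnvelope f

/-- An injective resolution `0 ⟶ M ⟶ I⁰ ⟶ I¹ ⟶ ⋯` is minimal if for every `i` the module
`ker (Iⁱ ⟶ Iⁱ⁺¹)` (that is, the image of `M` if `i = 0`, and of `Iⁱ⁻¹` if `i > 0`) is essential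
in `Iⁱ`. -/
def IsMinimalInjectiveResolution {Λ : Type u} [Ring Λ] {M : ModuleCat.{u} Λ}
    (I : InjectiveResolution M) : Prop :=
  ∀ i : ℕ, IsEssentialSubmodule (LinearMap.ker (I.cocomplex.d i (i + 1)).hom)

/-- The (left) global dimension: the supremum of the projective dimensions of left modules. -/
noncomputable def globalDimension (Λ : Type u) [Ring Λ] : WithBot ℕ∞ :=
  ⨆ M : ModuleCat.{u} Λ, projectiveDimension M

/-- The property of `Λ` that makes an Artinian algebra an `m`-Auslander algebra (for `m ≥ 1`):
`gl.dim Λ ≤ m + 1`, and the terms `I⁰(Λ), …, Iᵐ(Λ)` of a minimal injective resolution of the left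
module `Λ` are projective. -/
def IsAuslanderAlgebra (Λ : Type u) [Ring Λ] (m : ℕ) : Prop :=
  globalDimension Λ ≤ ((m + 1 : ℕ) : WithBot ℕ∞) ∧
    ∃ I : InjectiveResolution (ModuleCat.of Λ Λ), IsMinimalInjectiveResolution I ∧
      ∀ i : ℕ, i ≤ m → Projective (I.cocomplex.X i)

/-- `mod Λ`: the finitely generated left `Λ`-modules. -/
def finMod (Λ : Type u) [Ring Λ] : ObjectProperty (ModuleCat.{u} Λ) :=
  fun M => Module.Finite Λ M

section

variable {Λ : Type u} [Ring Λ]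

/-- `f : D ⟶ C` is a left `𝒞`-approximation of `D`. -/
def IsLeftApproximation (𝒞 : ObjectProperty (ModuleCat.{u} Λ)) {D C : ModuleCat.{u} Λ}
    (f : D ⟶ C) : Prop :=
  𝒞 C ∧ ∀ (C' : ModuleCat.{u} Λ), 𝒞 C' → ∀ g : D ⟶ C', ∃ h : C ⟶ C', f ≫ h = g

/-- `f : C ⟶ D` is a right `𝒞`-approximation of `D`. -/
def IsRightApproximation (𝒞 : ObjectProperty (ModuleCat.{u} Λ)) {D C : ModuleCat.{u} Λ}
    (f : C ⟶ D) : Prop :=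
  𝒞 C ∧ ∀ (C' : ModuleCat.{u} Λ), 𝒞 C' → ∀ g : C' ⟶ D, ∃ h : C' ⟶ C, h ≫ f = g

/-- `𝒞` is covariantly and contravariantly finite in `𝒟`. -/
def IsFunctoriallyFinite (𝒞 𝒟 : ObjectProperty (ModuleCat.{u} Λ)) : Prop :=
  ∀ D : ModuleCat.{u} Λ, 𝒟 D →
    (∃ (C : ModuleCat.{u} Λ) (f : D ⟶ C), IsLeftApproximation 𝒞 f) ∧
    (∃ (C : ModuleCat.{u} Λ) (f : C ⟶ D), IsRightApproximation 𝒞 f)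

/-- `^{⊥_n}𝒞`: the `X` in `mod Λ` with `Extⁱ(X, C) = 0` for all `C` in `𝒞` and `1 ≤ i ≤ n`. -/
def leftOrthogonal (n : ℕ) (𝒞 : ObjectProperty (ModuleCat.{u} Λ)) :
    ObjectProperty (ModuleCat.{u} Λ) :=
  fun X => finMod Λ X ∧ ∀ C : ModuleCat.{u} Λ, 𝒞 C → ∀ i : ℕ, 1 ≤ i → i ≤ n →
    Subsingleton (Abelian.Ext.{u} X C i)

/-- `𝒞^{⊥_n}`: the `X` in `mod Λ` with `Extⁱ(C, X) = 0` for all `C` in `𝒞` and `1 ≤ i ≤ n`. -/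
def rightOrthogonal (n : ℕ) (𝒞 : ObjectProperty (ModuleCat.{u} Λ)) :
    ObjectProperty (ModuleCat.{u} Λ) :=
  fun X => finMod Λ X ∧ ∀ C : ModuleCat.{u} Λ, 𝒞 C → ∀ i : ℕ, 1 ≤ i → i ≤ n →
    Subsingleton (Abelian.Ext.{u} C X i)

/-- `𝒞` is a maximal `n`-orthogonal subcategory of the full subcategory `𝒟` of `mod Λ`
(for `n ≥ 1`). -/
structure IsMaximalOrthogonal (n : ℕ) (𝒞 𝒟 : ObjectProperty (ModuleCat.{u} Λ)) : Prop where
  le : 𝒞 ≤ 𝒟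
  functoriallyFinite : IsFunctoriallyFinite 𝒞 𝒟
  eq_left : 𝒞 = leftOrthogonal n 𝒞 ⊓ 𝒟
  eq_right : 𝒞 = rightOrthogonal n 𝒞 ⊓ 𝒟

end

end HigherAuslander

/-! Every finitely generated module embeds into a finitely generated injective one: over a
commutative artinian ring an essential extension of a finitely generated module is finitely
generated, as one sees by filtering it with powers of the radical, and coinduction carries such
embeddings from the centre of `Λ` to `Λ`.

Put `d = n - 1` and embed `S` in a finitely generated injective `I`. Then `id S ≤ d` holds if and
only if `S ⟶ I` is a left `𝒞`-approximation. One direction is dimension shifting. For the other one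
shows that the approximation property passes to cokernels: since `gl.dim Λ ≤ d + 1`, the image of a
map from an injective module to a module of `𝒞` has injective dimension at most `d`, so that its
inclusion extends over an injective module, and an indecomposable of `𝒞` that contains such an image
is injective by Fitting's lemma. Fitting's lemma also shows that `S ⟶ I` is a left `𝒞`-approximation
exactly when every indecomposable of `𝒞` which receives a nonzero map from `S` is the injective
envelope of `S`. Projective modules receive no such map, because `pd S = gl.dim Λ`. -/

namespace HigherAuslander

section InjectiveEnvelope

theorem exists_le_maximal_disjoint {α : Type*} [CompleteLattice α] [IsCompactlyGenerated α]
    {a b : α} (h : Disjoint a b) : ∃ c, a ≤ c ∧ Maximal (Disjoint · b) c :=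
  zorn_le_nonempty₀ {c | Disjoint c b}
    (fun c hc hchain _ _ =>
      ⟨sSup c, hchain.directedOn.disjoint_sSup_left.2 hc, fun _ => le_sSup⟩) a h

variable {R : Type u} [Ring R]

theorem isCompl_of_maximal_disjoint {Q : Type*} [AddCommGroup Q] [Module R Q]
    [Module.Injective R Q] {E P : Submodule R Q} (hE : Maximal (Disjoint · P) E)
    (hP : Maximal (Disjoint · E) P) : IsCompl E P := by
  have hinj : Function.Injective (P.mkQ ∘ₗ E.subtype) := by
    rw [← LinearMap.ker_eq_bot, LinearMap.ker_comp, Submodule.ker_mkQ,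
      ← Submodule.disjoint_iff_comap_eq_bot]
    exact hE.prop
  -- The extension of `E ⟶ Q` over `Q ⧸ P` will turn out to be a projection onto `E` along `P`.
  obtain ⟨h, hh⟩ := Module.Injective.out _ hinj E.subtype
  let φ : Q →ₗ[R] Q := h ∘ₗ P.mkQ
  have hφE : ∀ x ∈ E, φ x = x := fun x hx => hh ⟨x, hx⟩
  have hPφ : ∀ N : Submodule R Q, P ≤ N.comap φ := fun N x hx => by
    simp [φ, (Submodule.Quotient.mk_eq_zero P).2 hx]
  have comap_le : ∀ N : Submodule R Q, Disjoint N E → N.comap φ ≤ P := fun N hN =>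
    hP.le_of_ge (Submodule.disjoint_def.2 fun x hxN hxE =>
      Submodule.disjoint_def.1 hN x (hφE x hxE ▸ hxN) hxE) (hPφ N)
  have hrange : LinearMap.range φ ≤ E := by
    refine hE.le_of_ge (Submodule.disjoint_def.2 ?_) fun x hx => ⟨x, hφE x hx⟩
    rintro _ ⟨x, rfl⟩ hx
    simpa using hPφ ⊥ (comap_le P hP.prop hx)
  have hker : LinearMap.ker φ = P := (comap_le ⊥ disjoint_bot_left).antisymm (hPφ ⊥)
  have := LinearMap.isCompl_of_proj (f := φ.codRestrict E fun x => hrange ⟨x, rfl⟩)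
    fun x => Subtype.ext (hφE x x.2)
  rwa [LinearMap.ker_codRestrict, hker] at this

theorem exists_isInjectiveEnvelope (M : ModuleCat.{u} R) :
    ∃ (E : ModuleCat.{u} R) (f : M ⟶ E), IsInjectiveEnvelope f := by
  let Q := Injective.under M
  let ι : M ⟶ Q := Injective.ι M
  have := Module.injective_module_of_injective_object R Q (inj := inferInstanceAs (Injective Q))
  let U : Submodule R Q := LinearMap.range ι.hom
  obtain ⟨P, -, hP⟩ := exists_le_maximal_disjoint (disjoint_bot_left (a := U))
  obtain ⟨E, hUE, hE⟩ := exists_le_maximal_disjoint hP.prop.symm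
  have hc : IsCompl E P := isCompl_of_maximal_disjoint hE
    ⟨hE.prop.symm, fun P' hP' hle => hP.le_of_ge (hP'.mono_right hUE) hle⟩
  let f : M ⟶ ModuleCat.of R E :=
    ModuleCat.ofHom (ι.hom.codRestrict E fun x => hUE ⟨x, rfl⟩)
  let r : Retract (ModuleCat.of R E) Q :=
    { i := ModuleCat.ofHom E.subtype
      r := ModuleCat.ofHom (E.projectionOnto P hc)
      retract := ModuleCat.hom_ext (LinearMap.ext (Submodule.projectionOnto_apply_left hc)) }
  have hfι : f ≫ r.i = ι := rfl
  refine ⟨ModuleCat.of R E, f, mono_of_mono_fac hfι, r.injective, fun N hN hNU => hN ?_⟩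
  have hN' : Disjoint (N.map E.subtype) U := by
    rw [Submodule.disjoint_def]
    rintro _ ⟨x, hx, rfl⟩ ⟨m, hm⟩
    have : x ∈ N ⊓ LinearMap.range f.hom := ⟨hx, m, Subtype.ext hm⟩
    simpa [hNU] using this
  have hNE : N.map E.subtype ≤ E := Submodule.map_subtype_le E N
  have hNP : N.map E.subtype ≤ P := le_sup_right.trans <| hP.le_of_ge
    (hN'.disjoint_sup_left_of_disjoint_sup_right (hE.prop.symm.mono_right (sup_le hNE hUE)))
    le_sup_left
  exact Submodule.map_injective_of_injective E.injective_subtype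
    ((disjoint_self.1 (hE.prop.mono hNE hNP)).trans (Submodule.map_bot _).symm)

theorem IsEssentialSubmodule.le_of_isSemisimpleModule {E : Type u} [AddCommGroup E] [Module R E]
    {U : Submodule R E} (hU : IsEssentialSubmodule U) (T : Submodule R E)
    [IsSemisimpleModule R T] : T ≤ U := by
  obtain ⟨W, hW⟩ := exists_isCompl (U.comap T.subtype)
  have hWU : W.map T.subtype ⊓ U = ⊥ := by
    rw [Submodule.map_inf_eq_map_inf_comap, inf_comm, hW.inf_eq_bot, Submodule.map_bot]
  have hW0 : W = ⊥ := by
    by_contra hW0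
    refine hU _ (fun h => hW0 ?_) hWU
    exact Submodule.map_injective_of_injective T.injective_subtype
      (h.trans (Submodule.map_bot _).symm)
  exact Submodule.comap_subtype_eq_top.1 (by simpa [hW0] using hW.sup_eq_top)

end InjectiveEnvelope

section ArtinianCentre

theorem isNoetherian_torsionBySet_pow {R M : Type*} [CommRing R] [AddCommGroup M] [Module R M]
    {I : Ideal R} (hI : I.FG) [IsNoetherian R (Submodule.torsionBySet R M I)] (k : ℕ) :
    IsNoetherian R (Submodule.torsionBySet R M ↑(I ^ k)) := by
  induction k with
  | zero =>
    have : Submodule.torsionBySet R M ↑(I ^ 0) = ⊥ := by simp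
    rw [this]
    infer_instance
  | succ k ih =>
    obtain ⟨d, g, hg⟩ := Submodule.fg_iff_exists_fin_generating_family.1 hI
    have hgI : ∀ j, g j ∈ I := fun j => hg ▸ Submodule.subset_span ⟨j, rfl⟩
    have htors : Submodule.torsionBySet R M I = Submodule.torsionBySet R M (Set.range g) := by
      rw [← hg, Ideal.submodule_span_eq, ← Submodule.torsionBySet_eq_torsionBySet_span]
    -- Multiplication by generators of `I` embeds `M[Iᵏ⁺¹] ⧸ M[I]` into a power of `M[Iᵏ]`.
    let f : Submodule.torsionBySet R M ↑(I ^ (k + 1)) →ₗ[R]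
        Fin d → Submodule.torsionBySet R M ↑(I ^ k) :=
      LinearMap.pi fun j => (LinearMap.lsmul R M (g j)).restrict fun x hx => by
        rw [Submodule.mem_torsionBySet_iff] at hx ⊢
        rintro ⟨r, hr⟩
        simpa [smul_smul] using hx ⟨r * g j, pow_succ I k ▸ Ideal.mul_mem_mul hr (hgI j)⟩
    have hker : (LinearMap.ker f).map (Submodule.subtype _) ≤ Submodule.torsionBySet R M I := by
      rw [htors]
      rintro _ ⟨x, hx, rfl⟩
      rw [Submodule.mem_torsionBySet_iff]
      rintro ⟨_, j, rfl⟩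
      exact congrArg Subtype.val (congrFun (LinearMap.mem_ker.1 hx) j)
    have := isNoetherian_of_le hker
    have : IsNoetherian R (LinearMap.ker f) :=
      isNoetherian_of_linearEquiv (Submodule.equivSubtypeMap _ (LinearMap.ker f)).symm
    exact isNoetherian_of_range_eq_ker (LinearMap.ker f).subtype f (Submodule.range_subtype _)

theorem IsEssentialSubmodule.isNoetherian {R E : Type u} [CommRing R] [IsArtinianRing R]
    [AddCommGroup E] [Module R E] {U : Submodule R E} (hU : IsEssentialSubmodule U)
    [IsNoetherian R U] : IsNoetherian R E := by
  let T := Submodule.torsionBySet R E (Ring.jacobson R)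
  have : IsSemisimpleModule R T :=
    (Submodule.torsionBySet_isTorsionBySet (Ring.jacobson R : Set R)).isSemisimpleModule_iff.1
      inferInstance
  have : IsNoetherian R T := isNoetherian_of_le (hU.le_of_isSemisimpleModule T)
  obtain ⟨k, hk⟩ := IsSemiprimaryRing.isNilpotent (R := R)
  have h := isNoetherian_torsionBySet_pow (M := E) (IsNoetherian.noetherian (Ring.jacobson R)) k
  have htop : Submodule.torsionBySet R E ↑(Ring.jacobson R ^ k) = ⊤ :=
    eq_top_iff.2 fun x _ => by simp [hk]
  rw [htop] at h
  exact isNoetherian_of_linearEquiv Submodule.topEquiv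

end ArtinianCentre

section EnoughInjectives

theorem finMod_restrictScalars {R Λ : Type u} [CommRing R] [Ring Λ] [Algebra R Λ]
    [Module.Finite R Λ] {X : ModuleCat.{u} Λ} (hX : finMod Λ X) :
    finMod R ((ModuleCat.restrictScalars (algebraMap R Λ)).obj X) := by
  let _ : Module R X := Module.compHom X (algebraMap R Λ)
  have : IsScalarTower R Λ X := IsScalarTower.of_algebraMap_smul fun _ _ => rfl
  have : Module.Finite Λ X := hX
  exact Module.Finite.trans (R := R) Λ X

theorem finMod_coextendScalars {R Λ : Type u} [CommRing R] [IsNoetherianRing R] [Ring Λ]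
    [Algebra R Λ] [Module.Finite R Λ] {E : ModuleCat.{u} R} (hE : finMod R E) :
    finMod Λ ((ModuleCat.coextendScalars (algebraMap R Λ)).obj E) := by
  let X := (ModuleCat.coextendScalars (algebraMap R Λ)).obj E
  let N := (ModuleCat.restrictScalars (algebraMap R Λ)).obj (ModuleCat.of Λ Λ)
  let _ : Module R X := Module.compHom X (algebraMap R Λ)
  have : IsScalarTower R Λ X := IsScalarTower.of_algebraMap_smul fun _ _ => rfl
  let e : X →ₗ[R] N →ₗ[R] E :=
    { ModuleCat.CoextendScalars.equiv (algebraMap R Λ) E with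
      map_smul' := fun r x => LinearMap.ext fun (l : Λ) => by
        let g : N →ₗ[R] E := ModuleCat.CoextendScalars.equiv (algebraMap R Λ) E x
        exact (congrArg g (Algebra.commutes r l).symm).trans (g.map_smul r l) }
  have : Module.Finite R N := finMod_restrictScalars (inferInstanceAs (Module.Finite Λ Λ))
  have : Module.Finite R E := hE
  have : IsNoetherian R X := isNoetherian_of_injective e
    (ModuleCat.CoextendScalars.equiv (algebraMap R Λ) E).injective
  exact Module.Finite.of_restrictScalars_finite R Λ X

/-- `mod Λ` has enough injectives: every finitely generated module embeds into a finitely generated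
injective module. -/
def FinModHasEnoughInjectives (Λ : Type u) [Ring Λ] : Prop :=
  ∀ X : ModuleCat.{u} Λ, finMod Λ X →
    ∃ (I : ModuleCat.{u} Λ) (f : X ⟶ I), finMod Λ I ∧ Injective I ∧ Mono f

theorem finModHasEnoughInjectives_of_isArtinianRing (R : Type u) [CommRing R] [IsArtinianRing R] :
    FinModHasEnoughInjectives R := fun X hX => by
  have : Module.Finite R X := hX
  obtain ⟨E, f, hf⟩ := exists_isInjectiveEnvelope X
  have : IsNoetherian R (LinearMap.range f.hom) := inferInstance
  have := hf.essential.isNoetherian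
  exact ⟨E, f, inferInstanceAs (Module.Finite R E), hf.injective, hf.mono⟩

theorem FinModHasEnoughInjectives.of_algebra {R Λ : Type u} [CommRing R] [IsNoetherianRing R]
    [Ring Λ] [Algebra R Λ] [Module.Finite R Λ] (hR : FinModHasEnoughInjectives R) :
    FinModHasEnoughInjectives Λ := fun X hX => by
  let F := ModuleCat.restrictScalars.{u} (algebraMap R Λ)
  let adj := ModuleCat.restrictCoextendScalarsAdj (algebraMap R Λ)
  obtain ⟨E, f, hE, hEinj, hf⟩ := hR (F.obj X) (finMod_restrictScalars hX)
  let P := adj.injectivePresentationOfMap X ⟨E, hEinj, f, hf⟩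
  exact ⟨P.J, P.f, finMod_coextendScalars hE, P.injective, P.mono⟩

theorem finModHasEnoughInjectives (R : Type*) [CommRing R] [IsArtinianRing R]
    (Λ : Type u) [Ring Λ] [Algebra R Λ] [Module.Finite R Λ] : FinModHasEnoughInjectives Λ := by
  -- `R` may live in another universe than `Λ`, whereas the centre of `Λ` does not.
  let _ : Algebra (Subalgebra.center R Λ) Λ := inferInstanceAs (Algebra (Subring.center Λ) Λ)
  have : IsArtinianRing (Subalgebra.center R Λ) := isArtinian_of_tower R
    (inferInstanceAs (IsArtinian R (Subalgebra.toSubmodule (Subalgebra.center R Λ))))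
  have : Module.Finite (Subalgebra.center R Λ) Λ := .of_restrictScalars_finite R _ Λ
  exact (finModHasEnoughInjectives_of_isArtinianRing (Subalgebra.center R Λ)).of_algebra

end EnoughInjectives

section Indecomposable

variable {Λ : Type u} [Ring Λ]

theorem eq_bot_or_eq_bot_of_isCompl {C : ModuleCat.{u} Λ} (hC : Indecomposable C)
    {A B : Submodule Λ C} (h : IsCompl A B) : A = ⊥ ∨ B = ⊥ := by
  let e : C ≅ ModuleCat.of Λ A ⊞ ModuleCat.of Λ B :=
    (Submodule.prodEquivOfIsCompl A B h).symm.toModuleIso ≪≫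
      (ModuleCat.biprodIsoProd (ModuleCat.of Λ A) (ModuleCat.of Λ B)).symm
  exact (hC.2 _ _ e).imp
    (fun hA => Submodule.subsingleton_iff_eq_bot.1 (ModuleCat.subsingleton_of_isZero hA))
    (fun hB => Submodule.subsingleton_iff_eq_bot.1 (ModuleCat.subsingleton_of_isZero hB))

theorem indecomposable_induction {Q : ModuleCat.{u} Λ → Prop}
    (zero : ∀ Y, Limits.IsZero Y → Q Y) (indecomposable : ∀ Y, Indecomposable Y → Q Y)
    (biprod : ∀ Y Z W : ModuleCat.{u} Λ, (W ≅ Y ⊞ Z) → Q Y → Q Z → Q W)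
    (X : ModuleCat.{u} Λ) [IsNoetherian Λ X] [IsArtinian Λ X] : Q X := by
  suffices h : ∀ l : ℕ∞, l ≠ ⊤ → ∀ Y : ModuleCat.{u} Λ, Module.length Λ Y = l → Q Y from
    h _ Module.length_ne_top X rfl
  intro l
  induction l using WellFoundedLT.induction with
  | ind l ih =>
    rintro hl W rfl
    by_cases h0 : Limits.IsZero W
    · exact zero W h0
    by_cases hind : Indecomposable W
    · exact indecomposable W hind
    obtain ⟨Y, Z, e, hY, hZ⟩ :
        ∃ (Y Z : ModuleCat.{u} Λ) (_ : W ≅ Y ⊞ Z), ¬ Limits.IsZero Y ∧ ¬ Limits.IsZero Z := by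
      by_contra! h
      exact hind ⟨h0, fun Y Z e => or_iff_not_imp_left.2 (h Y Z e)⟩
    have hlen : Module.length Λ W = Module.length Λ Y + Module.length Λ Z := by
      rw [← Module.length_prod]
      exact (e ≪≫ ModuleCat.biprodIsoProd Y Z).toLinearEquiv.length_eq
    rw [hlen] at hl ih
    obtain ⟨hlY, hlZ⟩ := WithTop.add_ne_top.1 hl
    have length_pos {M : ModuleCat.{u} Λ} (hM : ¬ Limits.IsZero M) : 0 < Module.length Λ M :=
      Module.length_pos_iff.2 (not_subsingleton_iff_nontrivial.1 fun _ =>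
        hM (ModuleCat.isZero_of_subsingleton M))
    exact biprod Y Z W e
      (ih _ (add_comm (Module.length Λ Y) _ ▸ ENat.lt_add_left hlY (length_pos hZ)) hlY Y rfl)
      (ih _ (ENat.lt_add_left hlZ (length_pos hY)) hlZ Z rfl)

variable {C : ModuleCat.{u} Λ} [IsNoetherian Λ C] [IsArtinian Λ C]

theorem bijective_of_apply_eq_self (hC : Indecomposable C) (φ : C →ₗ[Λ] C) {x : C} (hx : x ≠ 0)
    (hφ : φ x = x) : Function.Bijective φ := by
  have hxn : ∀ n : ℕ, (φ ^ n) x = x := fun n => by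
    rw [Module.End.pow_apply]
    exact Function.iterate_fixed hφ n
  have hrange : (⨅ n, LinearMap.range (φ ^ n)) ≠ ⊥ := fun h => hx <| by
    simpa [h] using (Submodule.mem_iInf _).2 fun n => LinearMap.mem_range.2 ⟨x, hxn n⟩
  -- In the Fitting decomposition of `φ` the summand on which `φ` is bijective contains `x`.
  have hker : (⨆ n, LinearMap.ker (φ ^ n)) = ⊥ :=
    (eq_bot_or_eq_bot_of_isCompl hC φ.isCompl_iSup_ker_pow_iInf_range_pow).resolve_right hrange
  have hφker : LinearMap.ker φ = ⊥ :=
    eq_bot_iff.2 (hker ▸ pow_one φ ▸ le_iSup (fun n => LinearMap.ker (φ ^ n)) 1)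
  exact IsArtinian.bijective_of_injective_endomorphism φ (LinearMap.ker_eq_bot.1 hφker)

theorem isIso_of_comp_eq_self (hC : Indecomposable C) {X : ModuleCat.{u} Λ} (φ : C ⟶ C)
    {g : X ⟶ C} (hg : g ≠ 0) (hφ : g ≫ φ = g) : IsIso φ := by
  obtain ⟨x, hx⟩ : ∃ x, g x ≠ 0 := by
    by_contra! h
    exact hg (by ext x; exact h x)
  exact (ConcreteCategory.isIso_iff_bijective φ).2
    (bijective_of_apply_eq_self hC φ.hom hx (by rw [← ConcreteCategory.comp_apply, hφ]))

theorem injective_of_comp_eq (hC : Indecomposable C) {X I : ModuleCat.{u} Λ} [Injective I]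
    {g : X ⟶ C} [Mono g] (hg : g ≠ 0) {i : X ⟶ I} {h : I ⟶ C} (hh : i ≫ h = g) :
    Injective C := by
  let k : C ⟶ I := Injective.factorThru i g
  have := isIso_of_comp_eq_self hC (k ≫ h) hg
    (by rw [Injective.comp_factorThru_assoc, hh])
  let r : Retract C I := ⟨k, h ≫ inv (k ≫ h), by rw [← Category.assoc, IsIso.hom_inv_id]⟩
  exact r.injective

theorem isInjectiveEnvelope_of_mono (hC : Indecomposable C) [Injective C] {X : ModuleCat.{u} Λ}
    (g : X ⟶ C) [Mono g] (hg : g ≠ 0) : IsInjectiveEnvelope g := by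
  refine ⟨inferInstance, inferInstance, fun N hN hNg => hN ?_⟩
  let q : C ⟶ ModuleCat.of Λ (C ⧸ N) := ModuleCat.ofHom N.mkQ
  have hq : Mono (g ≫ q) := by
    rw [ModuleCat.mono_iff_ker_eq_bot, ModuleCat.hom_comp, LinearMap.ker_comp,
      ModuleCat.hom_ofHom, Submodule.ker_mkQ, eq_bot_iff]
    intro x hx
    have hgx : g x ∈ N ⊓ LinearMap.range g.hom := ⟨hx, x, rfl⟩
    rw [hNg] at hgx
    exact (ModuleCat.mono_iff_injective g).1 inferInstance (hgx.trans (map_zero g.hom).symm)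
  let k : ModuleCat.of Λ (C ⧸ N) ⟶ C := Injective.factorThru g (g ≫ q)
  have hk : g ≫ q ≫ k = g := by
    rw [← Category.assoc, Injective.comp_factorThru]
  have := isIso_of_comp_eq_self hC (q ≫ k) hg hk
  have := mono_of_mono q k
  exact N.ker_mkQ.symm.trans (ModuleCat.ker_eq_bot_of_mono q)

end Indecomposable

section ExtSequences

universe w v

theorem shortExact_cokernel {A : Type u} [Category.{v} A] [Abelian A] {X I : A} (f : X ⟶ I)
    [Mono f] : (ShortComplex.mk f (Limits.cokernel.π f) (Limits.cokernel.condition f)).ShortExact :=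
  { exact := ShortComplex.exact_cokernel f }

open Abelian

variable {A : Type u} [Category.{v} A] [Abelian A] [HasExt.{w} A] {T : ShortComplex A}

theorem subsingleton_ext_X₁ (hT : T.ShortExact) (Y : A) (i : ℕ)
    (h₂ : Subsingleton (Ext.{w} T.X₂ Y i)) (h₃ : Subsingleton (Ext.{w} T.X₃ Y (i + 1))) :
    Subsingleton (Ext.{w} T.X₁ Y i) := by
  refine subsingleton_of_forall_eq 0 fun x => ?_
  obtain ⟨y, rfl⟩ := Ext.contravariant_sequence_exact₁ hT Y x (add_comm 1 i)
    (Subsingleton.elim _ _)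
  rw [Subsingleton.elim y 0, Ext.comp_zero]

theorem subsingleton_ext_X₃ (hT : T.ShortExact) (Y : A) (i : ℕ)
    (h₁ : Subsingleton (Ext.{w} T.X₁ Y i)) (h₂ : Subsingleton (Ext.{w} T.X₂ Y (i + 1))) :
    Subsingleton (Ext.{w} T.X₃ Y (i + 1)) := by
  refine subsingleton_of_forall_eq 0 fun x => ?_
  obtain ⟨y, rfl⟩ := Ext.contravariant_sequence_exact₃ hT Y x (Subsingleton.elim _ _)
    (add_comm 1 i)
  rw [Subsingleton.elim y 0, Ext.comp_zero]

theorem exists_factor_of_subsingleton_ext_one (hT : T.ShortExact) {Y : A}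
    (h₃ : Subsingleton (Ext.{w} T.X₃ Y 1)) (g : T.X₁ ⟶ Y) : ∃ h : T.X₂ ⟶ Y, T.f ≫ h = g := by
  obtain ⟨y, hy⟩ := Ext.contravariant_sequence_exact₁ hT Y (Ext.mk₀ g) (add_zero 1)
    (Subsingleton.elim _ _)
  obtain ⟨h, rfl⟩ := (Ext.mk₀_bijective _ _).2 y
  refine ⟨h, (Ext.mk₀_bijective _ _).1 ?_⟩
  rw [← hy, Ext.mk₀_comp_mk₀]

theorem subsingleton_ext_one_X₃ (hT : T.ShortExact) {Y : A}
    (h : ∀ g : T.X₁ ⟶ Y, ∃ h : T.X₂ ⟶ Y, T.f ≫ h = g) (h₂ : Subsingleton (Ext.{w} T.X₂ Y 1)) :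
    Subsingleton (Ext.{w} T.X₃ Y 1) := by
  refine subsingleton_of_forall_eq 0 fun x => ?_
  obtain ⟨y, rfl⟩ := Ext.contravariant_sequence_exact₃ hT Y x (Subsingleton.elim _ _)
    (add_zero 1)
  obtain ⟨g, rfl⟩ := (Ext.mk₀_bijective _ _).2 y
  obtain ⟨k, rfl⟩ := h g
  rw [← Ext.mk₀_comp_mk₀, ← Ext.comp_assoc_of_second_deg_zero, hT.extClass_comp, Ext.zero_comp]

theorem subsingleton_ext_of_retract_left {X Y : A} (r : Retract X Y) (Z : A) (i : ℕ)
    (h : Subsingleton (Ext.{w} Y Z i)) : Subsingleton (Ext.{w} X Z i) := by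
  refine subsingleton_of_forall_eq 0 fun x => ?_
  have h1 : (Ext.mk₀ r.i).comp ((Ext.mk₀ r.r).comp x (zero_add i)) (zero_add i) = x := by
    rw [Ext.mk₀_comp_mk₀_assoc, r.retract, Ext.mk₀_id_comp]
  rw [← h1, Subsingleton.elim ((Ext.mk₀ r.r).comp x (zero_add i)) 0, Ext.comp_zero]

end ExtSequences

section GlobalDimension

variable {Λ : Type u} [Ring Λ]

theorem hasProjectiveDimensionLT_of_globalDimension_le {n : ℕ}
    (hgl : globalDimension Λ ≤ n) (X : ModuleCat.{u} Λ) :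
    HasProjectiveDimensionLT X (n + 1) :=
  (projectiveDimension_le_iff X n).1
    ((le_iSup (fun X : ModuleCat.{u} Λ => projectiveDimension X) X).trans hgl)

theorem hasInjectiveDimensionLT_of_globalDimension_le {n : ℕ}
    (hgl : globalDimension Λ ≤ n) (X : ModuleCat.{u} Λ) :
    HasInjectiveDimensionLT X (n + 1) := by
  rw [hasInjectiveDimensionLT_iff.{u}]
  intro i hi Y e
  have := hasProjectiveDimensionLT_of_globalDimension_le hgl Y
  exact e.eq_zero_of_hasProjectiveDimensionLT (n + 1) hi

theorem hasProjectiveDimensionLT_of_mono {n : ℕ}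
    (hgl : globalDimension Λ ≤ (n + 1 : ℕ)) {X Q : ModuleCat.{u} Λ} [Projective Q]
    (g : X ⟶ Q) [Mono g] : HasProjectiveDimensionLT X (n + 1) :=
  (shortExact_cokernel g).hasProjectiveDimensionLT_X₁ (n + 1)
    (hasProjectiveDimensionLT_of_ge Q 1 (n + 1) (by omega))
    (hasProjectiveDimensionLT_of_globalDimension_le hgl _)

theorem hasInjectiveDimensionLT_of_epi {n : ℕ}
    (hgl : globalDimension Λ ≤ (n + 1 : ℕ)) {I X : ModuleCat.{u} Λ} [Injective I]
    (p : I ⟶ X) [Epi p] : HasInjectiveDimensionLT X (n + 1) :=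
  have hse : (ShortComplex.mk (Limits.kernel.ι p) p (Limits.kernel.condition p)).ShortExact :=
    { exact := ShortComplex.exact_kernel p }
  hse.hasInjectiveDimensionLT_X₃ (n + 1) (hasInjectiveDimensionLT_of_ge I 1 (n + 1) (by omega))
    (hasInjectiveDimensionLT_of_globalDimension_le hgl _)

theorem subsingleton_hom_of_projective {n : ℕ}
    (hgl : globalDimension Λ ≤ (n + 1 : ℕ)) {S : ModuleCat.{u} Λ} [Simple S]
    (hpd : projectiveDimension S = (n + 1 : ℕ)) (Q : ModuleCat.{u} Λ)
    [Projective Q] : Subsingleton (S ⟶ Q) := by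
  refine subsingleton_of_forall_eq 0 fun g => ?_
  by_contra hg
  have := mono_of_nonzero_from_simple hg
  exact (projectiveDimension_lt_iff.2 (hasProjectiveDimensionLT_of_mono hgl g)).ne hpd

end GlobalDimension

section FinMod

variable {Λ : Type u} [Ring Λ]

theorem finMod_of_epi {X Y : ModuleCat.{u} Λ} (f : X ⟶ Y) [hf : Epi f] (hX : finMod Λ X) :
    finMod Λ Y := by
  have : Module.Finite Λ X := hX
  exact Module.Finite.of_surjective f.hom ((ModuleCat.epi_iff_surjective f).1 hf)

theorem finMod_of_retract {X Y : ModuleCat.{u} Λ} (r : Retract X Y) (hY : finMod Λ Y) :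
    finMod Λ X :=
  finMod_of_epi r.r hY

theorem finMod_of_simple (S : ModuleCat.{u} Λ) [Simple S] : finMod Λ S := by
  have := isSimpleModule_of_simple S
  exact inferInstanceAs (Module.Finite Λ S)

end FinMod

section WeaklyMaximalOrthogonal

variable {Λ : Type u} [Ring Λ] {d : ℕ} {𝒞 : ObjectProperty (ModuleCat.{u} Λ)}

/-- `𝒞` is a weakly maximal `d`-orthogonal subcategory of `mod Λ`: it is determined by either of its
`Ext`-orthogonals in the way a maximal `d`-orthogonal subcategory is, but is not required to be
functorially finite. -/
structure IsWeaklyMaximalOrthogonal (d : ℕ) (𝒞 : ObjectProperty (ModuleCat.{u} Λ)) : Prop where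
  eq_left : 𝒞 = leftOrthogonal d 𝒞
  eq_right : 𝒞 = rightOrthogonal d 𝒞

theorem IsMaximalOrthogonal.isWeaklyMaximalOrthogonal
    (h : IsMaximalOrthogonal d 𝒞 (finMod Λ)) : IsWeaklyMaximalOrthogonal d 𝒞 where
  eq_left := h.eq_left.trans (inf_eq_left.2 fun _ hX => hX.1)
  eq_right := h.eq_right.trans (inf_eq_left.2 fun _ hX => hX.1)

namespace IsWeaklyMaximalOrthogonal

variable (h : IsWeaklyMaximalOrthogonal d 𝒞)

include h

theorem mem_iff_left (X : ModuleCat.{u} Λ) : 𝒞 X ↔ leftOrthogonal d 𝒞 X :=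
  iff_of_eq (congrFun h.eq_left X)

theorem mem_iff_right (X : ModuleCat.{u} Λ) : 𝒞 X ↔ rightOrthogonal d 𝒞 X :=
  iff_of_eq (congrFun h.eq_right X)

theorem finMod_of_mem {X : ModuleCat.{u} Λ} (hX : 𝒞 X) : finMod Λ X :=
  ((h.mem_iff_left X).1 hX).1

theorem subsingleton_ext {X C : ModuleCat.{u} Λ} (hX : 𝒞 X) (hC : 𝒞 C) {i : ℕ} (h1 : 1 ≤ i)
    (hi : i ≤ d) : Subsingleton (Abelian.Ext.{u} X C i) :=
  ((h.mem_iff_left X).1 hX).2 C hC i h1 hi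

theorem mem_of_injective {X : ModuleCat.{u} Λ} [Injective X] (hX : finMod Λ X) :
    𝒞 X :=
  (h.mem_iff_right X).2 ⟨hX, fun C _ i h1 _ => HasInjectiveDimensionLT.subsingleton X 1 i h1 C⟩

theorem mem_of_retract {X Y : ModuleCat.{u} Λ} (r : Retract X Y) (hY : 𝒞 Y) : 𝒞 X :=
  (h.mem_iff_left X).2 ⟨finMod_of_retract r (h.finMod_of_mem hY), fun C hC i h1 hi =>
    subsingleton_ext_of_retract_left r C i (h.subsingleton_ext hY hC h1 hi)⟩

theorem subsingleton_ext_of_hasInjectiveDimensionLT (hΛ : FinModHasEnoughInjectives Λ)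
    {C : ModuleCat.{u} Λ} (hC : 𝒞 C) (m : ℕ) {Y : ModuleCat.{u} Λ}
    (hY : finMod Λ Y) (hm : HasInjectiveDimensionLT Y (m + 1)) {j : ℕ}
    (h1 : 1 ≤ j) (hj : j + m ≤ d) : Subsingleton (Abelian.Ext.{u} Y C j) := by
  induction m generalizing Y j with
  | zero =>
    have : Injective Y := injective_iff_hasInjectiveDimensionLT_one.2 hm
    exact h.subsingleton_ext (h.mem_of_injective hY) hC h1 hj
  | succ m ih =>
    obtain ⟨I, f, hI, hIinj, hf⟩ := hΛ Y hY
    have hse := shortExact_cokernel f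
    have hm' := (hse.hasInjectiveDimensionLT_X₃_iff m hIinj).2 hm
    exact subsingleton_ext_X₁ hse C j
      (h.subsingleton_ext (h.mem_of_injective hI) hC h1 (by omega))
      (ih (finMod_of_epi (Limits.cokernel.π f) hI) hm' (by omega) (by omega))

theorem isLeftApproximation_of_hasInjectiveDimensionLT (hΛ : FinModHasEnoughInjectives Λ)
    {X J : ModuleCat.{u} Λ} (hX : HasInjectiveDimensionLT X (d + 1))
    (hJ : finMod Λ J) [Injective J] (i : X ⟶ J) [Mono i] :
    IsLeftApproximation 𝒞 i := by
  refine ⟨h.mem_of_injective hJ, fun C hC g => ?_⟩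
  have hse := shortExact_cokernel i
  cases d with
  | zero =>
    have : Injective X := injective_iff_hasInjectiveDimensionLT_one.2 hX
    exact ⟨Injective.factorThru (𝟙 X) i ≫ g, by simp⟩
  | succ e =>
    have hcoker := (hse.hasInjectiveDimensionLT_X₃_iff e inferInstance).2 hX
    exact exists_factor_of_subsingleton_ext_one hse
      (h.subsingleton_ext_of_hasInjectiveDimensionLT hΛ hC e
        (finMod_of_epi (Limits.cokernel.π i) hJ) hcoker le_rfl (by omega)) g

section IsArtinianRing

variable [IsArtinianRing Λ]

theorem isLeftApproximation_of_forall_indecomposable {X J : ModuleCat.{u} Λ} (hJ : 𝒞 J) (i : X ⟶ J)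
    (hind : ∀ C, 𝒞 C → Indecomposable C → ∀ g : X ⟶ C, ∃ k : J ⟶ C, i ≫ k = g) :
    IsLeftApproximation 𝒞 i := by
  refine ⟨hJ, fun C hC => ?_⟩
  have : Module.Finite Λ C := h.finMod_of_mem hC
  refine indecomposable_induction (Q := fun C => 𝒞 C → ∀ g : X ⟶ C, ∃ k : J ⟶ C, i ≫ k = g)
    ?zero ?indecomposable ?biprod C hC
  case zero => exact fun Y hY _ g => ⟨0, hY.eq_of_tgt _ _⟩
  case indecomposable => exact fun Y hY hYC g => hind Y hYC hY g
  case biprod =>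
    intro Y Z W e hY hZ hW g
    let rY : Retract Y W := ⟨Limits.biprod.inl ≫ e.inv, e.hom ≫ Limits.biprod.fst, by simp⟩
    let rZ : Retract Z W := ⟨Limits.biprod.inr ≫ e.inv, e.hom ≫ Limits.biprod.snd, by simp⟩
    obtain ⟨k, hk⟩ := hY (h.mem_of_retract rY hW) (g ≫ rY.r)
    obtain ⟨l, hl⟩ := hZ (h.mem_of_retract rZ hW) (g ≫ rZ.r)
    refine ⟨Limits.biprod.lift k l ≫ e.inv, ?_⟩
    rw [← Category.assoc, Iso.comp_inv_eq]
    exact Limits.biprod.hom_ext _ _ (by simp [hk, rY]) (by simp [hl, rZ])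

theorem injective_of_hom_ne_zero (hΛ : FinModHasEnoughInjectives Λ)
    (hgl : globalDimension Λ ≤ (d + 1 : ℕ)) {C I : ModuleCat.{u} Λ} (hC : 𝒞 C)
    (hind : Indecomposable C) (hI : finMod Λ I) [Injective I] {f : I ⟶ C}
    (hf : f ≠ 0) : Injective C := by
  let p := Limits.factorThruImage f
  have hid : HasInjectiveDimensionLT (Limits.image f) (d + 1) :=
    hasInjectiveDimensionLT_of_epi hgl p
  obtain ⟨J, i, hJ, _, _⟩ := hΛ (Limits.image f) (finMod_of_epi p hI)
  obtain ⟨k, hk⟩ := (h.isLeftApproximation_of_hasInjectiveDimensionLT hΛ hid hJ i).2 C hC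
    (Limits.image.ι f)
  have : Module.Finite Λ C := h.finMod_of_mem hC
  have hι : Limits.image.ι f ≠ 0 := fun h0 => hf <| by
    rw [← Limits.image.fac f, h0, Limits.comp_zero]
  exact injective_of_comp_eq hind hι hk

theorem isLeftApproximation_of_epi (hΛ : FinModHasEnoughInjectives Λ)
    (hgl : globalDimension Λ ≤ (d + 1 : ℕ)) {I Y J : ModuleCat.{u} Λ}
    (hI : finMod Λ I) [Injective I] (p : I ⟶ Y) [Epi p] (hJ : 𝒞 J) (i : Y ⟶ J)
    [Mono i] : IsLeftApproximation 𝒞 i := by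
  refine h.isLeftApproximation_of_forall_indecomposable hJ i fun C hC hind g => ?_
  by_cases hg : g = 0
  · exact ⟨0, by rw [hg, Limits.comp_zero]⟩
  · have hpg : p ≫ g ≠ 0 := fun h0 => hg (Limits.zero_of_epi_comp p h0)
    have := h.injective_of_hom_ne_zero hΛ hgl hC hind hI hpg
    exact ⟨Injective.factorThru g i, Injective.comp_factorThru g i⟩

theorem hasInjectiveDimensionLT_of_isLeftApproximation (hΛ : FinModHasEnoughInjectives Λ)
    (hgl : globalDimension Λ ≤ (d + 1 : ℕ)) (m : ℕ) {Y J : ModuleCat.{u} Λ}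
    (hY : finMod Λ Y) [Injective J] {i : Y ⟶ J} [Mono i]
    (hi : IsLeftApproximation 𝒞 i)
    (hext : ∀ C, 𝒞 C → ∀ j, 1 ≤ j → j + m ≤ d → Subsingleton (Abelian.Ext.{u} Y C j)) :
    HasInjectiveDimensionLT Y (m + 1) := by
  induction m generalizing Y J with
  | zero =>
    have hYC : 𝒞 Y := (h.mem_iff_left Y).2 ⟨hY, hext⟩
    obtain ⟨k, hk⟩ := hi.2 Y hYC (𝟙 Y)
    have : Injective Y := Retract.injective ⟨i, k, hk⟩
    infer_instance
  | succ m ih =>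
    have hse := shortExact_cokernel i
    have hJ : finMod Λ J := h.finMod_of_mem hi.1
    have hcoker : finMod Λ (Limits.cokernel i) :=
      finMod_of_epi (Limits.cokernel.π i) hJ
    obtain ⟨J', i', hJ', _, _⟩ := hΛ _ hcoker
    have hi' : IsLeftApproximation 𝒞 i' := h.isLeftApproximation_of_epi hΛ hgl hJ
      (Limits.cokernel.π i) (h.mem_of_injective hJ') i'
    refine (hse.hasInjectiveDimensionLT_X₃_iff m inferInstance).1 (ih hcoker hi' ?_)
    intro C hC j h1 hj
    have hJext := h.subsingleton_ext hi.1 hC h1 (by omega)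
    obtain _ | _ | j := j
    · omega
    · exact subsingleton_ext_one_X₃ hse (hi.2 C hC) hJext
    · exact subsingleton_ext_X₃ hse C _ (hext C hC _ (by omega) (by omega)) hJext

theorem hasInjectiveDimensionLT_iff_isLeftApproximation (hΛ : FinModHasEnoughInjectives Λ)
    (hgl : globalDimension Λ ≤ (d + 1 : ℕ)) {X J : ModuleCat.{u} Λ}
    (hX : finMod Λ X) (hJ : finMod Λ J) [Injective J] (i : X ⟶ J)
    [Mono i] : HasInjectiveDimensionLT X (d + 1) ↔ IsLeftApproximation 𝒞 i :=
  ⟨fun hid => h.isLeftApproximation_of_hasInjectiveDimensionLT hΛ hid hJ i,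
    fun hi => h.hasInjectiveDimensionLT_of_isLeftApproximation hΛ hgl d hX hi
      fun _ _ _ _ _ => by omega⟩

end IsArtinianRing

end IsWeaklyMaximalOrthogonal

end WeaklyMaximalOrthogonal

section Simple

variable {Λ : Type u} [Ring Λ] {d : ℕ} {𝒞 : ObjectProperty (ModuleCat.{u} Λ)}
  {S : ModuleCat.{u} Λ} [Simple S]

/-- `Hom(S, C) = 0` for every indecomposable `C` in `𝒞` with `C ≇ I⁰(S)`. -/
def HomVanishesOffEnvelope (𝒞 : ObjectProperty (ModuleCat.{u} Λ)) (S : ModuleCat.{u} Λ) : Prop :=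
  ∀ C : ModuleCat.{u} Λ, 𝒞 C → Indecomposable C → ¬ IsInjectiveEnvelopeOf S C →
    Subsingleton (S ⟶ C)

theorem homVanishesOffEnvelope_iff_forall_not_projective
    (hgl : globalDimension Λ ≤ (d + 1 : ℕ))
    (hpd : projectiveDimension S = (d + 1 : ℕ)) :
    HomVanishesOffEnvelope 𝒞 S ↔ ∀ C : ModuleCat.{u} Λ, 𝒞 C → Indecomposable C →
      ¬ Projective C → ¬ IsInjectiveEnvelopeOf S C → Subsingleton (S ⟶ C) := by
  refine ⟨fun hS C hC hind _ => hS C hC hind, fun hS C hC hind hSC => ?_⟩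
  by_cases hp : Projective C
  · exact subsingleton_hom_of_projective hgl hpd C
  · exact hS C hC hind hp hSC

namespace IsWeaklyMaximalOrthogonal

variable [IsArtinianRing Λ] (h : IsWeaklyMaximalOrthogonal d 𝒞)

include h

theorem isLeftApproximation_iff_homVanishesOffEnvelope {J : ModuleCat.{u} Λ} (hJ : finMod Λ J)
    [Injective J] (i : S ⟶ J) [Mono i] :
    IsLeftApproximation 𝒞 i ↔ HomVanishesOffEnvelope 𝒞 S := by
  constructor
  · refine fun hi C hC hind hSC => subsingleton_of_forall_eq 0 fun g => ?_
    by_contra hg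
    have := mono_of_nonzero_from_simple hg
    have : Module.Finite Λ C := h.finMod_of_mem hC
    obtain ⟨k, hk⟩ := hi.2 C hC g
    have := injective_of_comp_eq hind hg hk
    exact hSC ⟨g, isInjectiveEnvelope_of_mono hind g hg⟩
  · refine fun hS => h.isLeftApproximation_of_forall_indecomposable (h.mem_of_injective hJ) i
      fun C hC hind g => ?_
    by_cases hSC : IsInjectiveEnvelopeOf S C
    · have : Injective C := hSC.choose_spec.injective
      exact ⟨Injective.factorThru g i, Injective.comp_factorThru g i⟩
    · have := hS C hC hind hSC
      exact ⟨0, Subsingleton.elim _ _⟩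

variable (hΛ : FinModHasEnoughInjectives Λ)
  (hgl : globalDimension Λ ≤ (d + 1 : ℕ))

include hΛ hgl

theorem hasInjectiveDimensionLT_iff_homVanishesOffEnvelope :
    HasInjectiveDimensionLT S (d + 1) ↔ HomVanishesOffEnvelope 𝒞 S := by
  obtain ⟨J, i, hJ, _, _⟩ := hΛ S (finMod_of_simple S)
  rw [h.hasInjectiveDimensionLT_iff_isLeftApproximation hΛ hgl (finMod_of_simple S) hJ i,
    h.isLeftApproximation_iff_homVanishesOffEnvelope hJ i]

theorem injective_iff_mem_and_homVanishesOffEnvelope :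
    Injective S ↔ 𝒞 S ∧ HomVanishesOffEnvelope 𝒞 S := by
  refine ⟨fun hS => ⟨h.mem_of_injective (finMod_of_simple S), ?_⟩, fun ⟨hSC, hS⟩ => ?_⟩
  · exact (h.hasInjectiveDimensionLT_iff_homVanishesOffEnvelope hΛ hgl).1
      (hasInjectiveDimensionLT_of_ge S 1 (d + 1) (by omega))
  · by_contra hinj
    have := hS S hSC (indecomposable_of_simple S) fun ⟨_, hf⟩ => hinj hf.injective
    exact id_nonzero S (Subsingleton.elim _ _)

theorem injectiveDimension_mem_Icc_iff :
    1 ≤ injectiveDimension S ∧ injectiveDimension S ≤ d ↔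
      ¬ 𝒞 S ∧ HomVanishesOffEnvelope 𝒞 S := by
  have hone : 1 ≤ injectiveDimension S ↔ ¬ Injective S := by
    rw [injective_iff_hasInjectiveDimensionLT_one]
    exact injectiveDimension_ge_iff S 1
  have hle : injectiveDimension S ≤ d ↔ HasInjectiveDimensionLT S (d + 1) :=
    injectiveDimension_le_iff S d
  rw [hone, hle, h.injective_iff_mem_and_homVanishesOffEnvelope hΛ hgl,
    h.hasInjectiveDimensionLT_iff_homVanishesOffEnvelope hΛ hgl]
  tauto

theorem injectiveDimension_eq_iff_not_homVanishesOffEnvelope :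
    injectiveDimension S = (d + 1 : ℕ) ↔ ¬ HomVanishesOffEnvelope 𝒞 S := by
  have hle : injectiveDimension S ≤ (d + 1 : ℕ) :=
    (injectiveDimension_le_iff S (d + 1)).2 (hasInjectiveDimensionLT_of_globalDimension_le hgl S)
  rw [← h.hasInjectiveDimensionLT_iff_homVanishesOffEnvelope hΛ hgl, ← injectiveDimension_ge_iff]
  exact ⟨Eq.ge, hle.antisymm⟩

end IsWeaklyMaximalOrthogonal

end Simple

end HigherAuslander

open HigherAuslander in
theorem proposition3p9_general {Λ : Type u} [Ring Λ] [IsArtinianRing Λ]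
    (hΛ : FinModHasEnoughInjectives Λ) {d : ℕ}
    (hgl : globalDimension Λ ≤ (d + 1 : ℕ))
    {𝒞 : ObjectProperty (ModuleCat.{u} Λ)} (h𝒞 : IsWeaklyMaximalOrthogonal d 𝒞)
    (S : ModuleCat.{u} Λ) [Simple S]
    (hpd : projectiveDimension S = (d + 1 : ℕ)) :
    ((Injective S ↔
        𝒞 S ∧ ∀ C : ModuleCat.{u} Λ, 𝒞 C → Indecomposable C →
          ¬ IsInjectiveEnvelopeOf S C → Subsingleton (S ⟶ C)) ∧
      (Injective S ↔
        𝒞 S ∧ ∀ C : ModuleCat.{u} Λ, 𝒞 C → Indecomposable C → ¬ Projective C →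
          ¬ IsInjectiveEnvelopeOf S C → Subsingleton (S ⟶ C))) ∧
    ((1 ≤ injectiveDimension S ∧ injectiveDimension S ≤ d ↔
        ¬ 𝒞 S ∧ ∀ C : ModuleCat.{u} Λ, 𝒞 C → Indecomposable C →
          ¬ IsInjectiveEnvelopeOf S C → Subsingleton (S ⟶ C)) ∧
      (1 ≤ injectiveDimension S ∧ injectiveDimension S ≤ d ↔
        ¬ 𝒞 S ∧ ∀ C : ModuleCat.{u} Λ, 𝒞 C → Indecomposable C → ¬ Projective C →
          ¬ IsInjectiveEnvelopeOf S C → Subsingleton (S ⟶ C))) ∧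
    ((injectiveDimension S = (d + 1 : ℕ) ↔
        ∃ C : ModuleCat.{u} Λ, 𝒞 C ∧ Indecomposable C ∧
          ¬ IsInjectiveEnvelopeOf S C ∧ Nontrivial (S ⟶ C)) ∧
      (injectiveDimension S = (d + 1 : ℕ) ↔
        ∃ C : ModuleCat.{u} Λ, 𝒞 C ∧ Indecomposable C ∧ ¬ Projective C ∧
          ¬ IsInjectiveEnvelopeOf S C ∧ Nontrivial (S ⟶ C))) := by
  have hinj := h𝒞.injective_iff_mem_and_homVanishesOffEnvelope (S := S) hΛ hgl
  have hIcc := h𝒞.injectiveDimension_mem_Icc_iff (S := S) hΛ hgl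
  have heq := h𝒞.injectiveDimension_eq_iff_not_homVanishesOffEnvelope (S := S) hΛ hgl
  have hnp := homVanishesOffEnvelope_iff_forall_not_projective (𝒞 := 𝒞) hgl hpd
  refine ⟨⟨hinj, hinj.trans (and_congr_right' hnp)⟩,
    ⟨hIcc, hIcc.trans (and_congr_right' hnp)⟩, ?_, ?_⟩
  · simpa only [HomVanishesOffEnvelope, not_forall, not_subsingleton_iff_nontrivial,
      exists_prop] using heq
  · simpa only [hnp, not_forall, not_subsingleton_iff_nontrivial, exists_prop] using heq

theorem proposition3p9 {R : Type*} [CommRing R] [IsArtinianRing R]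
    {Λ : Type u} [Ring Λ] [Algebra R Λ] [Module.Finite R Λ]
    (n : ℕ) (hn : 2 ≤ n)
    (hΛ : HigherAuslander.IsAuslanderAlgebra Λ (n - 1))
    (hgl : HigherAuslander.globalDimension Λ = (n : WithBot ℕ∞))
    (𝒞 : ObjectProperty (ModuleCat.{u} Λ))
    (h𝒞 : HigherAuslander.IsMaximalOrthogonal (n - 1) 𝒞 (HigherAuslander.finMod Λ))
    (S : ModuleCat.{u} Λ) (hS : Simple S)
    (hpd : projectiveDimension S = (n : WithBot ℕ∞)) :
    -- each part is stated with `C` ranging over all indecomposables of `𝒞`, and again with `C`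
    -- ranging over the non-projective ones only
    ((Injective S ↔
        𝒞 S ∧ ∀ C : ModuleCat.{u} Λ, 𝒞 C → Indecomposable C →
          ¬ HigherAuslander.IsInjectiveEnvelopeOf S C → Subsingleton (S ⟶ C)) ∧
      (Injective S ↔
        𝒞 S ∧ ∀ C : ModuleCat.{u} Λ, 𝒞 C → Indecomposable C → ¬ Projective C →
          ¬ HigherAuslander.IsInjectiveEnvelopeOf S C → Subsingleton (S ⟶ C))) ∧
    ((1 ≤ injectiveDimension S ∧ injectiveDimension S ≤ ((n - 1 : ℕ) : WithBot ℕ∞) ↔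
        ¬ 𝒞 S ∧ ∀ C : ModuleCat.{u} Λ, 𝒞 C → Indecomposable C →
          ¬ HigherAuslander.IsInjectiveEnvelopeOf S C → Subsingleton (S ⟶ C)) ∧
      (1 ≤ injectiveDimension S ∧ injectiveDimension S ≤ ((n - 1 : ℕ) : WithBot ℕ∞) ↔
        ¬ 𝒞 S ∧ ∀ C : ModuleCat.{u} Λ, 𝒞 C → Indecomposable C → ¬ Projective C →
          ¬ HigherAuslander.IsInjectiveEnvelopeOf S C → Subsingleton (S ⟶ C))) ∧
    ((injectiveDimension S = (n : WithBot ℕ∞) ↔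
        ∃ C : ModuleCat.{u} Λ, 𝒞 C ∧ Indecomposable C ∧
          ¬ HigherAuslander.IsInjectiveEnvelopeOf S C ∧ Nontrivial (S ⟶ C)) ∧
      (injectiveDimension S = (n : WithBot ℕ∞) ↔
        ∃ C : ModuleCat.{u} Λ, 𝒞 C ∧ Indecomposable C ∧ ¬ Projective C ∧
          ¬ HigherAuslander.IsInjectiveEnvelopeOf S C ∧ Nontrivial (S ⟶ C))) := by
  obtain ⟨d, rfl⟩ := Nat.exists_eq_add_of_le' (one_le_two.trans hn)
  have : IsArtinianRing Λ := isArtinian_of_tower R inferInstance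
  exact proposition3p9_general (HigherAuslander.finModHasEnoughInjectives R Λ) hgl.le
    h𝒞.isWeaklyMaximalOrthogonal S hpd
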